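/- For every integer $m\ge 0$ and every real $\sigma$ there is a constant $C>0$, depending only on $m$ and $\sigma$, with the following property. Let $D\subset\mathbb R^2$ be a bounded open set and let $\mathcal T_h$ be a triangular mesh of $D$, that is, a finite set of nondegenerate closed triangles with pairwise disjoint interiors contained in $D$ and with union $\overline D$ (conforming or not). Assume that $\mathcal T_h$ is shape regular with constant $\sigma$: $h_T/\rho_T\le\sigma$ for all $T\in\mathcal T_h$, where $h_T$ is the diameter of $T$ and $\rho_T$ the diameter of the largest disc contained in $T$. Let $H\ge 1$ be such that $h_T\le H$ for all $T\in\mathcal T_h$. Let $V_h\subset L^2(D)$ be a finite element space of degree $m$ on $\mathcal T_h$, that is, a linear subspace with $v_h|_T\in\mathcal P_m(T)$ (polynomials of total degree at most $m$) for all $v_h\in V_h$ and $T\in\mathcal T_h$. Then $$\sum_{T\in\mathcal T_h}h_T^2\,\|v_h\|_{0,T}^2\le C\,H^2\,\|v_h\|_{-1,D}^2\qquad\text{for all } v_h\in V_h .$$ In particular, if $h_T\le 1$ for all $T\in\mathcal T_h$, then $$\sum_{T\in\mathcal T_h}h_T^2\,\|v_h\|_{0,T}^2\le C\,\|v_h\|_{-1,D}^2\qquad\text{for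 all } v_h\in V_h .$$ Here $\|\cdot\|_{0,T}$ is the norm of $L^2(T)$ and $$\|v\|_{-1,D}=\sup_{0\ne w\in H^1_0(D)}\frac{(v,w)_D}{\|w\|_{1,D}},\qquad \|w\|_{1,D}^2=\|w\|_{0,D}^2+\|\nabla w\|_{0,D}^2,$$ where $(\cdot,\cdot)_D$ is the scalar product of $L^2(D)$ and $H^1_0(D)$ is the closure of $C_c^\infty(D)$ in $H^1(D)$ (the supremum is $0$ if $D=\emptyset$). -/

import Mathlib

open MeasureTheory

noncomputable section

namespace FEM

/-- The Euclidean plane. -/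
abbrev Plane : Type := EuclideanSpace ℝ (Fin 2)

/-! ### Sobolev spaces -/

/-- The Lebesgue space `L²(D)` of real functions. -/
abbrev L2 (D : Set Plane) : Type := Lp ℝ 2 (volume.restrict D)

/-- The Lebesgue space `L²(D)²` of vector fields. -/
abbrev L2Vec (D : Set Plane) : Type := Lp Plane 2 (volume.restrict D)

/-- Pairs `(w, g)` in `L²(D) × L²(D)²`, with the Hilbert norm `(‖w‖² + ‖g‖²)^{1/2}`.
A function `w` of `H¹(D)` is represented by the pair `(w, ∇w)`, whose norm is the
full norm `‖w‖_{1,D}`. -/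
abbrev L2Pair (D : Set Plane) : Type := WithLp 2 (L2 D × L2Vec D)

/-- The pairs `(φ, ∇φ)` with `φ` a smooth function whose support is a compact subset of `D`. -/
def testPairs (D : Set Plane) : Set (L2Pair D) :=
  {p | ∃ φ : Plane → ℝ, ContDiff ℝ (⊤ : ℕ∞) φ ∧ HasCompactSupport φ ∧ tsupport φ ⊆ D ∧
    (p.fst =ᵐ[volume.restrict D] φ) ∧
    (p.snd =ᵐ[volume.restrict D] fun x => gradient φ x)}

/-- `H¹₀(D)`: the closure of the smooth compactly supported functions in the norm of `H¹(D)`.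
An element is a pair `(w, ∇w)`; its norm is `(‖w‖²_{0,D} + ‖∇w‖²_{0,D})^{1/2}`. -/
def H10 (D : Set Plane) : Submodule ℝ (L2Pair D) :=
  (Submodule.span ℝ (testPairs D)).topologicalClosure

/-- `H⁻¹(D)`, the dual space of `H¹₀(D)`, with the dual norm. -/
abbrev HMinusOne (D : Set Plane) : Type := StrongDual ℝ (H10 D)

/-- The element `w ↦ (v, w)_D` of `H⁻¹(D)` given by a function `v ∈ L²(D)`. -/
def toHMinusOne {D : Set Plane} (v : L2 D) : HMinusOne D :=
  (innerSL ℝ v).comp ((WithLp.fstL 2 ℝ (L2 D) (L2Vec D)).comp (H10 D).subtypeL)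

/-- The norm `‖v‖_{-1,D} = sup_{w ∈ H¹₀(D)} (v, w)_D / ‖w‖_{1,D}`. -/
def normMinusOne {D : Set Plane} (v : L2 D) : ℝ := ‖toHMinusOne v‖

/-- The pairing is the `L²(D)` scalar product. -/
theorem toHMinusOne_apply {D : Set Plane} (v : L2 D) (w : H10 D) :
    toHMinusOne v w = ∫ x in D, v x * (w : L2Pair D).fst x := by
  change inner ℝ v (w : L2Pair D).fst = _
  rw [L2.inner_def]
  refine integral_congr_ae (Filter.Eventually.of_forall fun x => ?_)
  simp [mul_comm]

/-! ### Triangular meshes -/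

/-- The closed triangle spanned by three affinely independent points. -/
def carrier (T : Affine.Triangle ℝ Plane) : Set Plane := convexHull ℝ (Set.range T.points)

/-- The diameter `h_T` of a triangle. -/
def diameter (T : Affine.Triangle ℝ Plane) : ℝ := Metric.diam (carrier T)

/-- The diameter `ρ_T` of the largest disc contained in a triangle. -/
def inDiameter (T : Affine.Triangle ℝ Plane) : ℝ :=
  sSup {d : ℝ | 0 ≤ d ∧ ∃ x : Plane, Metric.closedBall x (d / 2) ⊆ carrier T}

/-- A triangular mesh of `D`: finitely many nondegenerate closed triangles with pairwise
disjoint interiors contained in `D`, whose union is the closure of `D`.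
Hanging nodes are allowed, so conforming triangulations are a special case. -/
structure Mesh (D : Set Plane) where
  cells : Finset (Affine.Triangle ℝ Plane)
  iUnion_cells : ⋃ T ∈ cells, carrier T = closure D
  interior_subset : ∀ T ∈ cells, interior (carrier T) ⊆ D
  disjoint_interior : ∀ T ∈ cells, ∀ T' ∈ cells, T ≠ T' →
    Disjoint (interior (carrier T)) (interior (carrier T'))

/-- Shape regularity with constant `σ`: `h_T / ρ_T ≤ σ` for every triangle. -/
def Mesh.ShapeRegular {D : Set Plane} (𝒯 : Mesh D) (σ : ℝ) : Prop :=
  ∀ T ∈ 𝒯.cells, diameter T / inDiameter T ≤ σ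

/-! ### Finite element functions -/

/-- The function of `L²(D)` restricted to the triangle `T` is a polynomial of total degree at
most `m`, that is, it belongs to `P_m(T)`. -/
def IsPolynomialOn {D : Set Plane} (m : ℕ) (T : Affine.Triangle ℝ Plane) (v : L2 D) : Prop :=
  ∃ p : MvPolynomial (Fin 2) ℝ, p.totalDegree ≤ m ∧
    v =ᵐ[volume.restrict (carrier T)] fun x : Plane => MvPolynomial.eval (fun i => x i) p

/-- A finite element space of degree `m` on the mesh: a linear subspace of `L²(D)` whose elements
are polynomials of degree at most `m` on every triangle. Any interelement continuity
and any boundary conditions are allowed, and none are required. -/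
def Mesh.IsFESpace {D : Set Plane} (𝒯 : Mesh D) (m : ℕ) (V : Submodule ℝ (L2 D)) : Prop :=
  ∀ v ∈ V, ∀ T ∈ 𝒯.cells, IsPolynomialOn m T v

/-- The norm `‖v‖_{0,T}` of `L²(T)`. -/
def normZero {D : Set Plane} (T : Affine.Triangle ℝ Plane) (v : L2 D) : ℝ :=
  (eLpNorm v 2 (volume.restrict (carrier T))).toReal

end FEM

end

/-!
The estimate is proved by testing `v` with a localized copy of itself. On each triangle `T` choose a
smooth cutoff `0 ≤ η_T ≤ 1` with compact support in the interior of `T`, and put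
`w = ∑ h_T² η_T v|_T`. This `w` is smooth with compact support in `D`, so it lies in `H¹₀(D)`
whatever the shape of `D` and whether or not the mesh is conforming, and
`(v, w)_D = S := ∑ h_T² ∫ η_T v²`. Since the supports of the summands are pairwise disjoint,
`‖w‖²_{1,D}` is the sum of their squared `H¹` norms (`Mesh.exists_sum_mem_H10`).

Two facts about polynomials of degree at most `m` on one triangle are needed: `∫ η_T p²` controls
`‖p‖²_{0,T}` and `h_T² ‖∇(η_T p)‖²_0`, with constants depending on `m` and `σ` only
(`exists_cell_cutoff`). They give `‖w‖²_{1,D} ≤ C H² S`, the factor `H²` coming from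
`h_T⁴ ‖η_T p‖²_0`. Then `S ≤ ‖v‖_{-1,D} ‖w‖_{1,D}` implies `S ≤ C H² ‖v‖²_{-1,D}`, and
`∑ h_T² ‖v‖²_{0,T} ≤ C S`.

The cutoff `η_T` is a dilated and translated copy of one bump function, supported in a disc inside `T`
of radius comparable to `ρ_T`. By shape regularity `T` lies in a disc with the same centre and a
radius that is a fixed multiple, so that no affine map to a reference triangle is required:
a dilation and a translation reduce both facts to concentric discs about the origin
(`exists_scaled_estimate`), where they say that linear maps on the finite-dimensional space of
polynomials are bounded by an injective one (`exists_integral_sq_le`,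
`exists_reference_estimate`). Injectivity holds because a polynomial that vanishes on a disc is
zero.
-/

namespace FEM

open Metric

/-! ### Polynomial functions -/

/-- The polynomial function on the plane given by a polynomial in two variables. -/
noncomputable def polyFun (p : MvPolynomial (Fin 2) ℝ) (x : Plane) : ℝ :=
  MvPolynomial.eval (fun i => x i) p

theorem polyFun_add (p q : MvPolynomial (Fin 2) ℝ) : polyFun (p + q) = polyFun p + polyFun q := by
  ext x; simp [polyFun]

theorem polyFun_smul (c : ℝ) (p : MvPolynomial (Fin 2) ℝ) : polyFun (c • p) = c • polyFun p := by
  ext x; simp [polyFun]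

theorem analyticOnNhd_polyFun (p : MvPolynomial (Fin 2) ℝ) :
    AnalyticOnNhd ℝ (polyFun p) Set.univ := by
  have h := AnalyticOnNhd.aeval_mvPolynomial (𝕜 := ℝ) (s := Set.univ)
    (f := fun (x : Plane) (i : Fin 2) => x i)
    (fun i => (EuclideanSpace.proj i : Plane →L[ℝ] ℝ).analyticOnNhd Set.univ) p
  exact h

theorem contDiff_polyFun (p : MvPolynomial (Fin 2) ℝ) : ContDiff ℝ (⊤ : ℕ∞) (polyFun p) :=
  (analyticOnNhd_polyFun p).contDiff

theorem continuous_polyFun (p : MvPolynomial (Fin 2) ℝ) : Continuous (polyFun p) :=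
  (contDiff_polyFun p).continuous

theorem eq_zero_of_polyFun_ae_eq_zero {p : MvPolynomial (Fin 2) ℝ} {x : Plane} {r : ℝ}
    (hr : 0 < r) (h : polyFun p =ᵐ[volume.restrict (ball x r)] 0) : p = 0 := by
  have h1 : Set.EqOn (polyFun p) 0 (ball x r) :=
    Measure.eqOn_open_of_ae_eq h isOpen_ball (continuous_polyFun p).continuousOn
      continuousOn_const
  have h2 : polyFun p =ᶠ[nhds x] 0 := h1.eventuallyEq_of_mem (ball_mem_nhds x hr)
  have h3 : polyFun p = 0 :=
    (analyticOnNhd_polyFun p).eq_of_eventuallyEq analyticOnNhd_const h2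
  refine MvPolynomial.funext fun y => ?_
  simpa [polyFun] using congrFun h3 (WithLp.toLp 2 y)

/-- The substitution of polynomials of degree at most one does not raise the total degree. -/
theorem totalDegree_bind₁_le {f : Fin 2 → MvPolynomial (Fin 2) ℝ}
    (hf : ∀ i, (f i).totalDegree ≤ 1) (p : MvPolynomial (Fin 2) ℝ) :
    (MvPolynomial.bind₁ f p).totalDegree ≤ p.totalDegree := by
  conv_lhs => rw [p.as_sum, map_sum]
  refine MvPolynomial.totalDegree_finsetSum_le fun s hs => ?_
  rw [MvPolynomial.bind₁_monomial]
  refine (MvPolynomial.totalDegree_mul _ _).trans ?_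
  rw [MvPolynomial.totalDegree_C, zero_add]
  refine (MvPolynomial.totalDegree_finsetProd _ _).trans ?_
  refine le_trans (Finset.sum_le_sum fun i _ => ?_) (MvPolynomial.le_totalDegree hs)
  exact (MvPolynomial.totalDegree_pow _ _).trans (by simpa using Nat.mul_le_mul_left (s i) (hf i))

/-- Polynomials of bounded total degree are stable under dilations and translations. -/
theorem exists_polyFun_comp_affine (p : MvPolynomial (Fin 2) ℝ) (x : Plane) {r : ℝ} (hr : r ≠ 0) :
    ∃ q : MvPolynomial (Fin 2) ℝ, q.totalDegree ≤ p.totalDegree ∧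
      ∀ z, polyFun q (r⁻¹ • (z - x)) = polyFun p z := by
  refine ⟨MvPolynomial.bind₁ (fun i => MvPolynomial.C (x i) + MvPolynomial.C r * MvPolynomial.X i)
    p, totalDegree_bind₁_le (fun i => ?_) p, fun z => ?_⟩
  · refine (MvPolynomial.totalDegree_add _ _).trans (max_le (by simp) ?_)
    exact (MvPolynomial.totalDegree_mul _ _).trans (by simp)
  · unfold polyFun
    have h := MvPolynomial.aeval_bind₁ (R := ℝ) (fun i => (r⁻¹ • (z - x)) i)
      (fun i => MvPolynomial.C (x i) + MvPolynomial.C r * MvPolynomial.X i) p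
    refine Eq.trans h ?_
    simp [mul_inv_cancel_left₀ hr, MvPolynomial.aeval_eq_eval]

/-! ### Norm inequalities on finite-dimensional spaces -/

/-- Every linear map on a finite-dimensional space factors through the range of an injective one,
and the factor is continuous because that range is finite-dimensional. -/
theorem exists_norm_le_of_injective {V X Y : Type*} [AddCommGroup V] [Module ℝ V]
    [FiniteDimensional ℝ V] [NormedAddCommGroup X] [NormedSpace ℝ X] [NormedAddCommGroup Y]
    [NormedSpace ℝ Y] (A : V →ₗ[ℝ] X) (hA : Function.Injective A) (B : V →ₗ[ℝ] Y) :
    ∃ C : ℝ, 0 ≤ C ∧ ∀ p, ‖B p‖ ≤ C * ‖A p‖ := by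
  let e := LinearEquiv.ofInjective A hA
  let f := LinearMap.toContinuousLinearMap (B ∘ₗ e.symm.toLinearMap)
  refine ⟨‖f‖, f.opNorm_nonneg, fun p => ?_⟩
  have h := f.le_opNorm (e p)
  simpa [f, e] using h

theorem norm_toLp_sq {α E : Type*} [MeasurableSpace α] {μ : Measure α} [NormedAddCommGroup E]
    [InnerProductSpace ℝ E] {f : α → E} (hf : MemLp f 2 μ) :
    ‖hf.toLp f‖ ^ 2 = ∫ x, ‖f x‖ ^ 2 ∂μ := by
  rw [← real_inner_self_eq_norm_sq, L2.inner_def]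
  refine integral_congr_ae ?_
  filter_upwards [hf.coeFn_toLp] with x hx
  rw [hx, real_inner_self_eq_norm_sq]

/-- A linear family of square integrable functions, as a linear map into `L²`. -/
noncomputable def linearToL2 {V α E : Type*} [AddCommGroup V] [Module ℝ V] [MeasurableSpace α]
    (μ : Measure α) [NormedAddCommGroup E] [NormedSpace ℝ E] (F : V →ₗ[ℝ] (α → E))
    (hF : ∀ p, MemLp (F p) 2 μ) : V →ₗ[ℝ] Lp E 2 μ where
  toFun p := (hF p).toLp (F p)
  map_add' p q := by
    rw [← MemLp.toLp_add]
    exact MemLp.toLp_congr _ _ (by rw [map_add])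
  map_smul' c p := by
    rw [RingHom.id_apply, ← MemLp.toLp_const_smul]
    exact MemLp.toLp_congr _ _ (by rw [map_smul])

/-- If a linear family of functions is square integrable and no nonzero member vanishes almost
everywhere for `μ`, its `L²(μ)` norm controls the norm of any other linear family. -/
theorem exists_integral_sq_le {V α β E F : Type*} [AddCommGroup V] [Module ℝ V]
    [FiniteDimensional ℝ V] [MeasurableSpace α] [MeasurableSpace β] {μ : Measure α}
    {ν : Measure β} [NormedAddCommGroup E] [InnerProductSpace ℝ E] [NormedAddCommGroup F]
    [InnerProductSpace ℝ F] (A : V →ₗ[ℝ] (α → E)) (hA : ∀ p, MemLp (A p) 2 μ)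
    (hA0 : ∀ p, A p =ᵐ[μ] 0 → p = 0) (B : V →ₗ[ℝ] (β → F)) (hB : ∀ p, MemLp (B p) 2 ν) :
    ∃ C : ℝ, 0 ≤ C ∧ ∀ p, ∫ x, ‖B p x‖ ^ 2 ∂ν ≤ C * ∫ x, ‖A p x‖ ^ 2 ∂μ := by
  have hinj : Function.Injective (linearToL2 μ A hA) := by
    rw [← LinearMap.ker_eq_bot, LinearMap.ker_eq_bot']
    intro p hp
    refine hA0 p ?_
    have h1 := (hA p).coeFn_toLp
    have h2 : (hA p).toLp (A p) = 0 := hp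
    rw [h2] at h1
    exact h1.symm.trans (Lp.coeFn_zero _ _ _)
  obtain ⟨C, hC, h⟩ := exists_norm_le_of_injective _ hinj (linearToL2 ν B hB)
  refine ⟨C ^ 2, sq_nonneg C, fun p => ?_⟩
  rw [← norm_toLp_sq (hB p), ← norm_toLp_sq (hA p), ← mul_pow]
  exact pow_le_pow_left₀ (norm_nonneg _) (h p) 2

/-! ### Gradients -/

theorem gradient_add {f g : Plane → ℝ} {x : Plane} (hf : DifferentiableAt ℝ f x)
    (hg : DifferentiableAt ℝ g x) : gradient (f + g) x = gradient f x + gradient g x := by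
  simp [gradient, fderiv_add hf hg]

theorem gradient_const_smul (c : ℝ) (f : Plane → ℝ) (x : Plane) :
    gradient (c • f) x = c • gradient f x := by
  simp [gradient, fderiv_const_smul_field]

theorem continuous_gradient {f : Plane → ℝ} (hf : ContDiff ℝ (⊤ : ℕ∞) f) :
    Continuous (gradient f) :=
  (LinearIsometryEquiv.continuous _).comp (hf.continuous_fderiv (by simp))

theorem tsupport_gradient_subset (f : Plane → ℝ) : tsupport (gradient f) ⊆ tsupport f := by
  refine closure_minimal (fun x hx => ?_) (isClosed_tsupport f)
  by_contra h
  refine hx ?_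
  have : fderiv ℝ f x = 0 := by
    by_contra h'
    exact h (support_fderiv_subset ℝ h')
  simp [gradient, this]

theorem gradient_comp_affine {f : Plane → ℝ} (hf : Differentiable ℝ f) (x : Plane) (r : ℝ)
    (z : Plane) :
    gradient (fun z => f (r⁻¹ • (z - x))) z = r⁻¹ • gradient f (r⁻¹ • (z - x)) := by
  have h1 : HasFDerivAt (fun z : Plane => r⁻¹ • (z - x))
      (r⁻¹ • ContinuousLinearMap.id ℝ Plane) z :=
    ((hasFDerivAt_id z).sub_const x).const_smul r⁻¹
  have h2 := ((hf (r⁻¹ • (z - x))).hasFDerivAt.comp z h1).fderiv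
  have h3 : fderiv ℝ (fun z => f (r⁻¹ • (z - x))) z = r⁻¹ • fderiv ℝ f (r⁻¹ • (z - x)) := by
    rw [show (fun z => f (r⁻¹ • (z - x))) = f ∘ fun z : Plane => r⁻¹ • (z - x) from rfl, h2]
    ext y; simp
  simp [gradient, h3]

/-! ### The estimates on a reference disc -/

/-- A smooth bump function equal to `1` on the disc of radius `1/4` about the origin, with
values in `[0, 1]` and supported in the disc of radius `1/2`. -/
noncomputable def refBump : ContDiffBump (0 : Plane) where
  rIn := 1 / 4
  rOut := 1 / 2
  rIn_pos := by norm_num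
  rIn_lt_rOut := by norm_num

theorem contDiff_bump_mul (p : MvPolynomial (Fin 2) ℝ) :
    ContDiff ℝ (⊤ : ℕ∞) (fun y => refBump y * polyFun p y) :=
  refBump.contDiff.mul (contDiff_polyFun p)

theorem hasCompactSupport_bump_mul (p : MvPolynomial (Fin 2) ℝ) :
    HasCompactSupport (fun y => refBump y * polyFun p y) :=
  refBump.hasCompactSupport.mul_right

theorem integrable_bump_mul_sq (p : MvPolynomial (Fin 2) ℝ) :
    Integrable (fun y => refBump y * polyFun p y ^ 2) :=
  (refBump.continuous.mul ((continuous_polyFun p).pow 2)).integrable_of_hasCompactSupport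
    refBump.hasCompactSupport.mul_right

/-- The map `p ↦ p` from polynomials of degree at most `m` to functions. -/
noncomputable def polyMap (m : ℕ) : MvPolynomial.restrictTotalDegree (Fin 2) ℝ m →ₗ[ℝ]
    (Plane → ℝ) where
  toFun p := polyFun p
  map_add' p q := polyFun_add p q
  map_smul' c p := polyFun_smul c p

/-- The map `p ↦ ∇(φ p)`, with `φ` the reference bump, from polynomials of degree at most `m`
to vector fields. -/
noncomputable def gradBumpMap (m : ℕ) : MvPolynomial.restrictTotalDegree (Fin 2) ℝ m →ₗ[ℝ]
    (Plane → Plane) where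
  toFun p := gradient (fun y => refBump y * polyFun p y)
  map_add' p q := by
    ext1 y
    rw [Pi.add_apply, ← gradient_add ((contDiff_bump_mul p).differentiable (by simp) y)
      ((contDiff_bump_mul q).differentiable (by simp) y)]
    congr 1
    ext1 z
    simp [polyFun_add, mul_add]
  map_smul' c p := by
    ext1 y
    rw [RingHom.id_apply, Pi.smul_apply, ← gradient_const_smul]
    congr 1
    ext1 z
    simp [polyFun_smul]
    ring

theorem memLp_polyFun_ball (p : MvPolynomial (Fin 2) ℝ) (x : Plane) (r : ℝ) :
    MemLp (polyFun p) 2 (volume.restrict (ball x r)) := by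
  refine (memLp_two_iff_integrable_sq (continuous_polyFun p).aestronglyMeasurable).2 ?_
  exact (((continuous_polyFun p).pow 2).continuousOn.integrableOn_compact
    (isCompact_closedBall x r)).mono_set ball_subset_closedBall

theorem memLp_gradient {f : Plane → ℝ} (hf : ContDiff ℝ (⊤ : ℕ∞) f) (hc : HasCompactSupport f) :
    MemLp (gradient f) 2 volume :=
  (continuous_gradient hf).memLp_of_hasCompactSupport
    (hc.of_isClosed_subset (isClosed_tsupport _) (tsupport_gradient_subset f))

theorem setIntegral_ball_le_bump (p : MvPolynomial (Fin 2) ℝ) :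
    ∫ y in ball (0 : Plane) (1 / 4), ‖polyFun p y‖ ^ 2 ≤ ∫ y, refBump y * polyFun p y ^ 2 := by
  rw [← integral_indicator measurableSet_ball]
  refine integral_mono_of_nonneg (Filter.Eventually.of_forall fun y => ?_)
    (integrable_bump_mul_sq p) (Filter.Eventually.of_forall fun y => ?_)
  · exact Set.indicator_nonneg (fun _ _ => by positivity) y
  · by_cases hy : y ∈ ball (0 : Plane) (1 / 4)
    · have h1 : refBump y = 1 := refBump.one_of_mem_closedBall (ball_subset_closedBall hy)
      rw [Set.indicator_of_mem hy]
      simp [h1]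
    · rw [Set.indicator_of_notMem hy]
      exact mul_nonneg refBump.nonneg (sq_nonneg (polyFun p y))

/-- On polynomials of degree at most `m`, the norm weighted by the bump controls the `L²` norm on
any disc about the origin and the `H¹` seminorm of the product with the bump. -/
theorem exists_reference_estimate (m : ℕ) (R : ℝ) :
    ∃ C : ℝ, 0 ≤ C ∧ ∀ p : MvPolynomial (Fin 2) ℝ, p.totalDegree ≤ m →
      ∫ y in ball (0 : Plane) R, polyFun p y ^ 2 ≤ C * ∫ y, refBump y * polyFun p y ^ 2 ∧
      ∫ y, ‖gradient (fun y => refBump y * polyFun p y) y‖ ^ 2 ≤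
        C * ∫ y, refBump y * polyFun p y ^ 2 := by
  have hA : ∀ p, MemLp (polyMap m p) 2 (volume.restrict (ball (0 : Plane) (1 / 4))) :=
    fun p => memLp_polyFun_ball p _ _
  have hA0 : ∀ p, polyMap m p =ᵐ[volume.restrict (ball (0 : Plane) (1 / 4))] 0 → p = 0 :=
    fun p hp => Subtype.ext (eq_zero_of_polyFun_ae_eq_zero (by norm_num) hp)
  obtain ⟨C₁, hC₁, h₁⟩ := exists_integral_sq_le _ hA hA0 (polyMap m)
    (ν := volume.restrict (ball (0 : Plane) R)) fun p => memLp_polyFun_ball p _ _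
  obtain ⟨C₂, hC₂, h₂⟩ := exists_integral_sq_le _ hA hA0 (gradBumpMap m) (ν := volume)
    fun p => memLp_gradient (contDiff_bump_mul p) (hasCompactSupport_bump_mul p)
  refine ⟨max C₁ C₂, le_max_of_le_left hC₁, fun p hp => ?_⟩
  have hp' : p ∈ MvPolynomial.restrictTotalDegree (Fin 2) ℝ m :=
    (MvPolynomial.mem_restrictTotalDegree _ _ _).2 hp
  have h₁' := h₁ ⟨p, hp'⟩
  have h₂' := h₂ ⟨p, hp'⟩
  have h0 : 0 ≤ ∫ y in ball (0 : Plane) (1 / 4), ‖polyFun p y‖ ^ 2 :=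
    integral_nonneg fun y => by positivity
  have hb := setIntegral_ball_le_bump p
  simp only [polyMap, gradBumpMap, LinearMap.coe_mk, AddHom.coe_mk] at h₁' h₂'
  constructor
  · calc _ = ∫ y in ball (0 : Plane) R, ‖polyFun p y‖ ^ 2 := by simp
      _ ≤ _ := h₁'
      _ ≤ _ := mul_le_mul (le_max_left _ _) hb h0 (le_max_of_le_left hC₁)
  · exact h₂'.trans (mul_le_mul (le_max_right _ _) hb h0 (le_max_of_le_left hC₁))

/-! ### Scaling to an arbitrary disc -/

theorem integral_comp_affine (f : Plane → ℝ) (x : Plane) {r : ℝ} (hr : 0 < r) :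
    ∫ z, f (r⁻¹ • (z - x)) = r ^ 2 * ∫ y, f y := by
  rw [integral_sub_right_eq_self (fun z => f (r⁻¹ • z)) x,
    Measure.integral_comp_inv_smul_of_nonneg _ _ hr.le]
  simp

/-- The reference estimates on discs of arbitrary centre and radius, with the scaling of the
gradient. -/
theorem exists_scaled_estimate (m : ℕ) (R : ℝ) :
    ∃ C : ℝ, 0 ≤ C ∧ ∀ (x : Plane) (r : ℝ), 0 < r →
      ∀ p : MvPolynomial (Fin 2) ℝ, p.totalDegree ≤ m →
      ∫ z in ball x (R * r), polyFun p z ^ 2 ≤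
        C * ∫ z, refBump (r⁻¹ • (z - x)) * polyFun p z ^ 2 ∧
      r ^ 2 * ∫ z, ‖gradient (fun z => refBump (r⁻¹ • (z - x)) * polyFun p z) z‖ ^ 2 ≤
        C * ∫ z, refBump (r⁻¹ • (z - x)) * polyFun p z ^ 2 := by
  obtain ⟨C, hC, h⟩ := exists_reference_estimate m R
  refine ⟨C, hC, fun x r hr p hp => ?_⟩
  obtain ⟨q, hq, hqp⟩ := exists_polyFun_comp_affine p x hr.ne'
  obtain ⟨h₁, h₂⟩ := h q (hq.trans hp)
  have e0 : ∫ z, refBump (r⁻¹ • (z - x)) * polyFun p z ^ 2 =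
      r ^ 2 * ∫ y, refBump y * polyFun q y ^ 2 := by
    rw [← integral_comp_affine (fun y => refBump y * polyFun q y ^ 2) x hr]
    simp_rw [hqp]
  have e1 : ∫ z in ball x (R * r), polyFun p z ^ 2 =
      r ^ 2 * ∫ y in ball (0 : Plane) R, polyFun q y ^ 2 := by
    rw [← integral_indicator measurableSet_ball, ← integral_indicator measurableSet_ball,
      ← integral_comp_affine _ x hr]
    refine integral_congr_ae (Filter.Eventually.of_forall fun z => ?_)
    have hz : r⁻¹ • (z - x) ∈ ball (0 : Plane) R ↔ z ∈ ball x (R * r) := by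
      rw [mem_ball_zero_iff, norm_smul, norm_inv, Real.norm_of_nonneg hr.le, mem_ball,
        dist_eq_norm, inv_mul_lt_iff₀ hr, mul_comm]
    by_cases hz' : z ∈ ball x (R * r)
    · simp only [Set.indicator_of_mem hz', Set.indicator_of_mem (hz.2 hz'), hqp]
    · simp only [Set.indicator_of_notMem hz', Set.indicator_of_notMem (mt hz.1 hz')]
  have e2 : r ^ 2 * ∫ z, ‖gradient (fun z => refBump (r⁻¹ • (z - x)) * polyFun p z) z‖ ^ 2 =
      r ^ 2 * ∫ y, ‖gradient (fun y => refBump y * polyFun q y) y‖ ^ 2 := by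
    rw [← integral_comp_affine
      (fun y => ‖gradient (fun y => refBump y * polyFun q y) y‖ ^ 2) x hr, ← integral_const_mul]
    refine integral_congr_ae (Filter.Eventually.of_forall fun z => ?_)
    have h3 := gradient_comp_affine ((contDiff_bump_mul q).differentiable (by simp)) x r z
    simp only [hqp] at h3
    simp only [h3, norm_smul, norm_inv, Real.norm_of_nonneg hr.le]
    field_simp
  rw [e0, e1, e2, mul_left_comm C]
  exact ⟨mul_le_mul_of_nonneg_left h₁ (sq_nonneg r), mul_le_mul_of_nonneg_left h₂ (sq_nonneg r)⟩

/-! ### Discs in triangles -/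

theorem isCompact_carrier (T : Affine.Triangle ℝ Plane) : IsCompact (carrier T) :=
  (Set.finite_range T.points).isCompact_convexHull ℝ

theorem nonempty_interior_carrier (T : Affine.Triangle ℝ Plane) :
    (interior (carrier T)).Nonempty := by
  rw [carrier, interior_convexHull_nonempty_iff_affineSpan_eq_top,
    T.independent.affineSpan_eq_top_iff_card_eq_finrank_add_one]
  simp

theorem bddAbove_inDiameter (T : Affine.Triangle ℝ Plane) :
    BddAbove {d : ℝ | 0 ≤ d ∧ ∃ x : Plane, closedBall x (d / 2) ⊆ carrier T} := by
  refine ⟨diameter T, fun d ⟨hd, x, hx⟩ => ?_⟩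
  calc d = diam (closedBall x (d / 2)) := by
        rw [diam_closedBall_eq x (by positivity)]; ring
    _ ≤ _ := diam_mono hx (isCompact_carrier T).isBounded

theorem inDiameter_pos (T : Affine.Triangle ℝ Plane) : 0 < inDiameter T := by
  obtain ⟨x, hx⟩ := nonempty_interior_carrier T
  obtain ⟨ε, hε, h⟩ := nhds_basis_closedBall.mem_iff.1 (mem_interior_iff_mem_nhds.1 hx)
  refine lt_of_lt_of_le (by positivity : 0 < 2 * ε)
    (le_csSup (bddAbove_inDiameter T) ⟨by positivity, x, ?_⟩)
  rwa [mul_div_cancel_left₀ ε two_ne_zero]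

/-- A triangle contains a disc of radius comparable to `ρ_T`. The factor `4` replaces `2`, so that
attainment of the supremum defining `ρ_T` is not needed. -/
theorem exists_closedBall_subset_carrier (T : Affine.Triangle ℝ Plane) :
    ∃ (x : Plane) (r : ℝ), 0 < r ∧ closedBall x r ⊆ carrier T ∧ inDiameter T ≤ 4 * r := by
  have hpos := inDiameter_pos T
  obtain ⟨d, ⟨_, x, hx⟩, hd⟩ := exists_lt_of_lt_csSup
    (s := {d : ℝ | 0 ≤ d ∧ ∃ x : Plane, closedBall x (d / 2) ⊆ carrier T})
    (b := inDiameter T / 2) (by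
      by_contra h
      rw [Set.not_nonempty_iff_eq_empty] at h
      rw [inDiameter, h, Real.sSup_empty] at hpos
      exact lt_irrefl 0 hpos) (half_lt_self hpos)
  exact ⟨x, d / 2, by linarith, hx, by linarith⟩

/-- On a shape-regular triangle there is a smooth cutoff `η`, compactly supported in the interior,
such that, for polynomials `p` of degree at most `m`, the weighted norm `∫ η p²` controls the
`L²(T)` norm of `p` and satisfies an inverse estimate, with a constant depending on `m` and `σ`
only. -/
theorem exists_cell_cutoff (m : ℕ) (σ : ℝ) :
    ∃ C : ℝ, 0 ≤ C ∧ ∀ T : Affine.Triangle ℝ Plane, diameter T / inDiameter T ≤ σ →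
      ∃ η : Plane → ℝ, ContDiff ℝ (⊤ : ℕ∞) η ∧ tsupport η ⊆ interior (carrier T) ∧
        (∀ z, 0 ≤ η z) ∧ (∀ z, η z ≤ 1) ∧
        ∀ p : MvPolynomial (Fin 2) ℝ, p.totalDegree ≤ m →
          ∫ z in carrier T, polyFun p z ^ 2 ≤ C * ∫ z, η z * polyFun p z ^ 2 ∧
          diameter T ^ 2 * ∫ z, ‖gradient (fun z => η z * polyFun p z) z‖ ^ 2 ≤
            C * ∫ z, η z * polyFun p z ^ 2 := by
  -- If `B(x, r) ⊆ T` with `ρ_T ≤ 4 r`, then `h_T ≤ σ ρ_T ≤ 4 |σ| r`; the extra `1` puts `T` inside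
  -- the open disc of radius `(4 |σ| + 1) r`.
  obtain ⟨C, hC, h⟩ := exists_scaled_estimate m (4 * |σ| + 1)
  refine ⟨C * (1 + 16 * σ ^ 2), by positivity, fun T hT => ?_⟩
  obtain ⟨x, r, hr, hx, hTr⟩ := exists_closedBall_subset_carrier T
  have hdiam : diameter T ≤ 4 * |σ| * r := by
    have h1 := (div_le_iff₀ (inDiameter_pos T)).1 hT
    have h2 : σ * inDiameter T ≤ |σ| * (4 * r) :=
      mul_le_mul (le_abs_self σ) hTr (inDiameter_pos T).le (abs_nonneg σ)
    linarith
  have hdiam0 : 0 ≤ diameter T := diam_nonneg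
  have hsub : carrier T ⊆ ball x ((4 * |σ| + 1) * r) := fun z hz => by
    have h1 : dist z x ≤ diameter T :=
      dist_le_diam_of_mem (isCompact_carrier T).isBounded hz (hx (mem_closedBall_self hr.le))
    rw [mem_ball]
    linarith
  refine ⟨fun z => refBump (r⁻¹ • (z - x)), ?_, ?_, fun z => refBump.nonneg,
    fun z => refBump.le_one, fun p hp => ?_⟩
  · exact refBump.contDiff.comp ((contDiff_id.sub contDiff_const).const_smul r⁻¹)
  -- The radius `1/2` of the reference bump keeps the support off the boundary of `B(x, r)`, and
  -- hence in the interior of the triangle, the only part known to lie in `D`.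
  · have h1 : tsupport (fun z => refBump (r⁻¹ • (z - x))) ⊆ closedBall x (r / 2) := by
      refine closure_minimal (fun z hz => ?_) isClosed_closedBall
      have h2 : r⁻¹ • (z - x) ∈ ball (0 : Plane) (1 / 2) := by
        rw [show (1 / 2 : ℝ) = refBump.rOut from rfl, ← refBump.support_eq]
        exact hz
      rw [mem_ball_zero_iff, norm_smul, norm_inv, Real.norm_of_nonneg hr.le,
        inv_mul_lt_iff₀ hr] at h2
      rw [mem_closedBall, dist_eq_norm]
      linarith
    refine h1.trans ((closedBall_subset_ball (half_lt_self hr)).trans ?_)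
    exact interior_maximal (ball_subset_closedBall.trans hx) isOpen_ball
  · obtain ⟨h1, h2⟩ := h x r hr p hp
    have hI : 0 ≤ ∫ z, refBump (r⁻¹ • (z - x)) * polyFun p z ^ 2 :=
      integral_nonneg fun z => mul_nonneg refBump.nonneg (sq_nonneg _)
    have hG : 0 ≤ ∫ z, ‖gradient (fun z => refBump (r⁻¹ • (z - x)) * polyFun p z) z‖ ^ 2 :=
      integral_nonneg fun z => by positivity
    have hCI := mul_nonneg hC hI
    constructor
    · have h3 : ∫ z in carrier T, polyFun p z ^ 2 ≤
          ∫ z in ball x ((4 * |σ| + 1) * r), polyFun p z ^ 2 :=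
        setIntegral_mono_set ((memLp_two_iff_integrable_sq
          (continuous_polyFun p).aestronglyMeasurable).1 (memLp_polyFun_ball p _ _))
          (Filter.Eventually.of_forall fun z => sq_nonneg _) hsub.eventuallyLE
      nlinarith [sq_nonneg σ]
    · have h4 : diameter T ^ 2 ≤ 16 * σ ^ 2 * r ^ 2 := by
        calc diameter T ^ 2 ≤ (4 * |σ| * r) ^ 2 := pow_le_pow_left₀ hdiam0 hdiam 2
          _ = _ := by rw [mul_pow, mul_pow, sq_abs]; ring
      have h5 := mul_le_mul_of_nonneg_right h4 hG
      have h6 := mul_le_mul_of_nonneg_left h2 (by positivity : 0 ≤ 16 * σ ^ 2)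
      simp only at h5 h6 ⊢
      nlinarith

/-! ### Test functions in `H¹₀(D)` -/

/-- A smooth function with compact support in `D` is an element of `H¹₀(D)`. -/
theorem exists_mem_H10 {D : Set Plane} {w : Plane → ℝ} (hw : ContDiff ℝ (⊤ : ℕ∞) w)
    (hc : HasCompactSupport w) (hD : tsupport w ⊆ D) :
    ∃ u : H10 D, ((u : L2Pair D).fst =ᵐ[volume.restrict D] w) ∧
      ‖u‖ ^ 2 ≤ (∫ x, w x ^ 2) + ∫ x, ‖gradient w x‖ ^ 2 := by
  have m1 : MemLp w 2 volume := hw.continuous.memLp_of_hasCompactSupport hc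
  have m2 := memLp_gradient hw hc
  have m1' := m1.restrict D
  have m2' := m2.restrict D
  let u : L2Pair D := WithLp.toLp 2 (m1'.toLp w, m2'.toLp (gradient w))
  have hu : u ∈ testPairs D := ⟨w, hw, hc, hD, m1'.coeFn_toLp, m2'.coeFn_toLp⟩
  refine ⟨⟨u, Submodule.le_topologicalClosure _ (Submodule.subset_span hu)⟩, m1'.coeFn_toLp, ?_⟩
  rw [Submodule.coe_norm, WithLp.prod_norm_sq_eq_of_L2]
  change ‖m1'.toLp w‖ ^ 2 + ‖m2'.toLp (gradient w)‖ ^ 2 ≤ _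
  rw [norm_toLp_sq, norm_toLp_sq]
  refine add_le_add ?_ ?_
  · simp only [Real.norm_eq_abs, sq_abs]
    exact setIntegral_le_integral m1.integrable_sq
      (Filter.Eventually.of_forall fun x => sq_nonneg _)
  · exact setIntegral_le_integral ((memLp_two_iff_integrable_sq_norm m2.1).1 m2)
      (Filter.Eventually.of_forall fun x => by positivity)

theorem norm_sum_sq_of_pairwise {ι E : Type*} [NormedAddCommGroup E] [InnerProductSpace ℝ E]
    (s : Finset ι) (f : ι → E) (h : ∀ i ∈ s, ∀ j ∈ s, i ≠ j → f i = 0 ∨ f j = 0) :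
    ‖∑ i ∈ s, f i‖ ^ 2 = ∑ i ∈ s, ‖f i‖ ^ 2 := by
  classical
  rw [← real_inner_self_eq_norm_sq, sum_inner]
  refine Finset.sum_congr rfl fun i hi => ?_
  rw [inner_sum, Finset.sum_eq_single i, real_inner_self_eq_norm_sq]
  · intro j hj hij
    rcases h i hi j hj hij.symm with h | h <;> simp [h]
  · exact fun hi' => absurd hi hi'

theorem gradient_sum {ι : Type*} (s : Finset ι) {f : ι → Plane → ℝ}
    (hf : ∀ i ∈ s, ContDiff ℝ (⊤ : ℕ∞) (f i)) (x : Plane) :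
    gradient (fun z => ∑ i ∈ s, f i z) x = ∑ i ∈ s, gradient (f i) x := by
  simp only [gradient]
  rw [fderiv_fun_sum fun i hi => (hf i hi).differentiable (by simp) x, map_sum]

/-- Smooth functions supported in the interiors of the cells of a mesh add up to an element of
`H¹₀(D)`, and the `H¹` norms decouple. -/
theorem Mesh.exists_sum_mem_H10 {D : Set Plane} (𝒯 : Mesh D)
    {f : Affine.Triangle ℝ Plane → Plane → ℝ}
    (hf : ∀ T ∈ 𝒯.cells, ContDiff ℝ (⊤ : ℕ∞) (f T))
    (hs : ∀ T ∈ 𝒯.cells, tsupport (f T) ⊆ interior (carrier T)) :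
    ∃ u : H10 D, ((u : L2Pair D).fst =ᵐ[volume.restrict D] fun x => ∑ T ∈ 𝒯.cells, f T x) ∧
      ‖u‖ ^ 2 ≤ ∑ T ∈ 𝒯.cells, ((∫ x, f T x ^ 2) + ∫ x, ‖gradient (f T) x‖ ^ 2) := by
  have hc : ∀ T ∈ 𝒯.cells, HasCompactSupport (f T) := fun T hT =>
    (isCompact_carrier T).of_isClosed_subset (isClosed_tsupport _)
      ((hs T hT).trans _root_.interior_subset)
  have hsup : tsupport (fun x => ∑ T ∈ 𝒯.cells, f T x) ⊆ ⋃ T ∈ 𝒯.cells, tsupport (f T) := by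
    refine closure_minimal (fun x hx => ?_)
      (𝒯.cells.finite_toSet.isClosed_biUnion fun T _ => isClosed_tsupport _)
    obtain ⟨T, hT, h⟩ := Finset.exists_ne_zero_of_sum_ne_zero hx
    exact Set.mem_biUnion hT (subset_tsupport _ h)
  have hdisj : ∀ x, ∀ T ∈ 𝒯.cells, ∀ T' ∈ 𝒯.cells, T ≠ T' →
      x ∉ tsupport (f T) ∨ x ∉ tsupport (f T') := by
    intro x T hT T' hT' hne
    by_contra! h
    exact Set.disjoint_left.1 (𝒯.disjoint_interior T hT T' hT' hne) (hs T hT h.1)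
      (hs T' hT' h.2)
  have hcomp : HasCompactSupport (fun x => ∑ T ∈ 𝒯.cells, f T x) :=
    (𝒯.cells.finite_toSet.isCompact_biUnion hc).of_isClosed_subset (isClosed_tsupport _) hsup
  obtain ⟨u, hu, hn⟩ := exists_mem_H10 (D := D)
    (ContDiff.sum fun T hT => hf T hT) hcomp
    (hsup.trans (Set.iUnion₂_subset fun T hT => (hs T hT).trans (𝒯.interior_subset T hT)))
  refine ⟨u, hu, hn.trans_eq ?_⟩
  rw [Finset.sum_add_distrib, ← integral_finsetSum, ← integral_finsetSum]
  · congr 1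
    · refine integral_congr_ae (Filter.Eventually.of_forall fun x => ?_)
      have h := norm_sum_sq_of_pairwise 𝒯.cells (fun T => f T x) fun T hT T' hT' hne =>
        (hdisj x T hT T' hT' hne).imp image_eq_zero_of_notMem_tsupport
          image_eq_zero_of_notMem_tsupport
      simpa only [Real.norm_eq_abs, sq_abs] using h
    · refine integral_congr_ae (Filter.Eventually.of_forall fun x => ?_)
      simp only [gradient_sum 𝒯.cells hf x]
      have hz : ∀ T, x ∉ tsupport (f T) → gradient (f T) x = 0 := fun T h =>
        image_eq_zero_of_notMem_tsupport fun h' => h (tsupport_gradient_subset _ h')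
      exact norm_sum_sq_of_pairwise 𝒯.cells (fun T => gradient (f T) x) fun T hT T' hT' hne =>
        (hdisj x T hT T' hT' hne).imp (hz T) (hz T')
  · intro T hT
    have h := memLp_gradient (hf T hT) (hc T hT)
    exact (memLp_two_iff_integrable_sq_norm h.1).1 h
  · intro T hT
    exact ((hf T hT).continuous.memLp_of_hasCompactSupport (hc T hT)).integrable_sq

/-! ### The inverse estimate -/

theorem normZero_sq {D : Set Plane} {T : Affine.Triangle ℝ Plane} {v : L2 D}
    {p : MvPolynomial (Fin 2) ℝ} (h : v =ᵐ[volume.restrict (carrier T)] polyFun p) :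
    normZero T v ^ 2 = ∫ x in carrier T, polyFun p x ^ 2 := by
  have hp : MemLp (polyFun p) 2 (volume.restrict (carrier T)) :=
    (memLp_two_iff_integrable_sq (continuous_polyFun p).aestronglyMeasurable).2
      (((continuous_polyFun p).pow 2).continuousOn.integrableOn_compact (isCompact_carrier T))
  rw [normZero, eLpNorm_congr_ae h, ← Lp.norm_toLp _ hp, norm_toLp_sq]
  simp

/-- Testing `v` with a cutoff of its own polynomial piece on `T` gives the weighted norm of that
piece, by the support of the cutoff. -/
theorem setIntegral_mul_cutoff {D : Set Plane} {T : Affine.Triangle ℝ Plane} {v : L2 D}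
    {p : MvPolynomial (Fin 2) ℝ} (h : v =ᵐ[volume.restrict (carrier T)] polyFun p)
    (hD : IsOpen D) (hTD : interior (carrier T) ⊆ D) {η : Plane → ℝ}
    (hη : tsupport η ⊆ interior (carrier T)) :
    ∫ x in D, v x * (η x * polyFun p x) = ∫ x, η x * polyFun p x ^ 2 := by
  have hz : ∀ x ∉ interior (carrier T), η x = 0 := fun x hx =>
    image_eq_zero_of_notMem_tsupport fun h' => hx (hη h')
  rw [setIntegral_eq_of_subset_of_forall_sdiff_eq_zero hD.measurableSet hTD
      fun x hx => by simp [hz x hx.2],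
    ← setIntegral_eq_integral_of_forall_compl_eq_zero (s := interior (carrier T))
      (f := fun x => η x * polyFun p x ^ 2) fun x hx => by simp [hz x hx]]
  refine integral_congr_ae ?_
  filter_upwards [ae_restrict_of_ae_restrict_of_subset interior_subset h] with x hx
  rw [hx]
  ring

end FEM

theorem mainTheorem11 (m : ℕ) (σ : ℝ) :
    ∃ C : ℝ, 0 < C ∧
      ∀ (D : Set FEM.Plane), IsOpen D → Bornology.IsBounded D →
      ∀ (𝒯 : FEM.Mesh D), 𝒯.ShapeRegular σ →
      ∀ (H : ℝ), 1 ≤ H → (∀ T ∈ 𝒯.cells, FEM.diameter T ≤ H) →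
      ∀ (V : Submodule ℝ (FEM.L2 D)), 𝒯.IsFESpace m V →
      ∀ v ∈ V,
        ∑ T ∈ 𝒯.cells, FEM.diameter T ^ 2 * FEM.normZero T v ^ 2
          ≤ C * H ^ 2 * FEM.normMinusOne v ^ 2 := by
  obtain ⟨K, hK, hcut⟩ := FEM.exists_cell_cutoff m σ
  -- The summand `1` keeps the constant positive when `K = 0`.
  refine ⟨K * (1 + K) + 1, by positivity, ?_⟩
  intro D hD _ 𝒯 hσ H hH hdiam V hV v hv
  choose! p hpdeg hp using fun T (hT : T ∈ 𝒯.cells) => hV v hv T hT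
  choose! η hηs hηsupp hη0 hη1 hη using fun T (hT : T ∈ 𝒯.cells) => hcut T (hσ T hT)
  have hbound := fun T hT => hη T hT (p T) (hpdeg T hT)
  -- The test function is `w = ∑ h_T² η_T v|_T`.
  let g : Affine.Triangle ℝ FEM.Plane → FEM.Plane → ℝ := fun T x => η T x * FEM.polyFun (p T) x
  let f : Affine.Triangle ℝ FEM.Plane → FEM.Plane → ℝ := fun T => FEM.diameter T ^ 2 • g T
  let I : Affine.Triangle ℝ FEM.Plane → ℝ := fun T => ∫ x, η T x * FEM.polyFun (p T) x ^ 2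
  have hg : ∀ T ∈ 𝒯.cells, ContDiff ℝ (⊤ : ℕ∞) (g T) := fun T hT =>
    (hηs T hT).mul (FEM.contDiff_polyFun _)
  have hf : ∀ T ∈ 𝒯.cells, ContDiff ℝ (⊤ : ℕ∞) (f T) := fun T hT =>
    (hg T hT).const_smul (FEM.diameter T ^ 2)
  have hfs : ∀ T ∈ 𝒯.cells, tsupport (f T) ⊆ interior (FEM.carrier T) := fun T hT =>
    (closure_mono fun x hx => mt (fun hx0 => by simp [f, g, hx0]) hx).trans (hηsupp T hT)
  have hηc : ∀ T ∈ 𝒯.cells, HasCompactSupport (η T) := fun T hT =>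
    (FEM.isCompact_carrier T).of_isClosed_subset (isClosed_tsupport _)
      ((hηsupp T hT).trans interior_subset)
  have hI : ∀ T ∈ 𝒯.cells, 0 ≤ I T := fun T hT =>
    integral_nonneg fun x => mul_nonneg (hη0 T hT x) (sq_nonneg _)
  obtain ⟨u, hu, hun⟩ := 𝒯.exists_sum_mem_H10 hf hfs
  set S := ∑ T ∈ 𝒯.cells, FEM.diameter T ^ 2 * I T with hS
  have hS0 : 0 ≤ S := Finset.sum_nonneg fun T hT => mul_nonneg (sq_nonneg _) (hI T hT)
  have hpair : FEM.toHMinusOne v u = S := by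
    rw [FEM.toHMinusOne_apply]
    calc ∫ x in D, v x * (u : FEM.L2Pair D).fst x
        = ∫ x in D, ∑ T ∈ 𝒯.cells, FEM.diameter T ^ 2 * (v x * g T x) := by
          refine integral_congr_ae ?_
          filter_upwards [hu] with x hx
          rw [hx, Finset.mul_sum]
          exact Finset.sum_congr rfl fun T _ => mul_left_comm _ _ _
      _ = ∑ T ∈ 𝒯.cells, ∫ x in D, FEM.diameter T ^ 2 * (v x * g T x) := by
          refine integral_finsetSum _ fun T hT => Integrable.const_mul ?_ _
          have hgT : MemLp (g T) 2 volume :=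
            (hg T hT).continuous.memLp_of_hasCompactSupport (hηc T hT).mul_right
          exact (Lp.memLp v).integrable_mul (hgT.restrict D)
      _ = S := Finset.sum_congr rfl fun T hT => by
          rw [integral_const_mul, FEM.setIntegral_mul_cutoff (hp T hT) hD
            (𝒯.interior_subset T hT) (hηsupp T hT)]
  have hnorm : ‖u‖ ^ 2 ≤ (1 + K) * H ^ 2 * S := by
    refine hun.trans ?_
    rw [hS, Finset.mul_sum]
    refine Finset.sum_le_sum fun T hT => ?_
    have hd0 : 0 ≤ FEM.diameter T := Metric.diam_nonneg
    have hd2 : FEM.diameter T ^ 2 ≤ H ^ 2 := pow_le_pow_left₀ hd0 (hdiam T hT) 2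
    have e1 : ∫ x, f T x ^ 2 ≤ FEM.diameter T ^ 4 * I T := by
      rw [← integral_const_mul]
      refine integral_mono_of_nonneg (Filter.Eventually.of_forall fun x => sq_nonneg _) ?_
        (Filter.Eventually.of_forall fun x => ?_)
      · exact (((hηs T hT).continuous.mul
          ((FEM.continuous_polyFun _).pow 2)).integrable_of_hasCompactSupport
            (hηc T hT).mul_right).const_mul _
      · have h1 : η T x ^ 2 ≤ η T x := by
          rw [sq]; exact mul_le_of_le_one_left (hη0 T hT x) (hη1 T hT x)
        calc f T x ^ 2 = FEM.diameter T ^ 4 * (η T x ^ 2 * FEM.polyFun (p T) x ^ 2) := by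
              simp only [f, g, Pi.smul_apply, smul_eq_mul]; ring
          _ ≤ FEM.diameter T ^ 4 * (η T x * FEM.polyFun (p T) x ^ 2) := by gcongr
    have e2 : ∫ x, ‖gradient (f T) x‖ ^ 2 ≤ FEM.diameter T ^ 2 * (K * I T) := by
      have h1 : ∫ x, ‖gradient (f T) x‖ ^ 2 =
          FEM.diameter T ^ 2 * (FEM.diameter T ^ 2 * ∫ x, ‖gradient (g T) x‖ ^ 2) := by
        rw [← mul_assoc, ← integral_const_mul]
        refine integral_congr_ae (Filter.Eventually.of_forall fun x => ?_)
        simp only [f, FEM.gradient_const_smul, norm_smul, norm_pow, Real.norm_of_nonneg hd0]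
        ring
      rw [h1]
      exact mul_le_mul_of_nonneg_left (hbound T hT).2 (sq_nonneg _)
    have hX : 0 ≤ FEM.diameter T ^ 2 * I T := mul_nonneg (sq_nonneg _) (hI T hT)
    calc _ ≤ FEM.diameter T ^ 4 * I T + FEM.diameter T ^ 2 * (K * I T) := add_le_add e1 e2
      _ = FEM.diameter T ^ 2 * (FEM.diameter T ^ 2 * I T) +
          K * 1 * (FEM.diameter T ^ 2 * I T) := by ring
      _ ≤ H ^ 2 * (FEM.diameter T ^ 2 * I T) +
          K * H ^ 2 * (FEM.diameter T ^ 2 * I T) := by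
          gcongr
          exact one_le_pow₀ hH
      _ = _ := by ring
  -- Cancelling one factor `S` in `S² ≤ ‖v‖²_{-1,D} ‖w‖²_{1,D} ≤ ‖v‖²_{-1,D} (1 + K) H² S`.
  have hdual : S ≤ (1 + K) * H ^ 2 * FEM.normMinusOne v ^ 2 := by
    have h1 : S ≤ FEM.normMinusOne v * ‖u‖ := by
      rw [← hpair]
      exact (le_abs_self _).trans ((FEM.toHMinusOne v).le_opNorm u)
    have h2 : S ^ 2 ≤ FEM.normMinusOne v ^ 2 * ((1 + K) * H ^ 2 * S) := by
      refine (pow_le_pow_left₀ hS0 h1 2).trans ?_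
      rw [mul_pow]
      exact mul_le_mul_of_nonneg_left hnorm (sq_nonneg _)
    rcases hS0.eq_or_lt with h | h
    · rw [← h]; positivity
    · refine le_of_mul_le_mul_right ?_ h
      linarith
  calc ∑ T ∈ 𝒯.cells, FEM.diameter T ^ 2 * FEM.normZero T v ^ 2
      ≤ ∑ T ∈ 𝒯.cells, FEM.diameter T ^ 2 * (K * I T) := by
        refine Finset.sum_le_sum fun T hT => mul_le_mul_of_nonneg_left ?_ (sq_nonneg _)
        rw [FEM.normZero_sq (hp T hT)]
        exact (hbound T hT).1
    _ = K * S := by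
        rw [hS, Finset.mul_sum]
        exact Finset.sum_congr rfl fun T _ => mul_left_comm _ _ _
    _ ≤ K * ((1 + K) * H ^ 2 * FEM.normMinusOne v ^ 2) := mul_le_mul_of_nonneg_left hdual hK
    _ ≤ _ := by nlinarith [mul_nonneg (sq_nonneg H) (sq_nonneg (FEM.normMinusOne v))]
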